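/- Let $H$ be a separable complex Hilbert space. For a bounded operator $T$ on $H$ and $n\ge 0$ put $\mu(n,T)=\inf\{\|T-R\|:\ R\in B(H),\ \mathrm{rank}(R)\le n\}$. For $0<p<\infty$ let $\mathcal L_{p,\infty}(H)$ be the set of all compact operators $T$ on $H$ with $\sup_{n\ge 0}(n+1)^{1/p}\mu(n,T)<\infty$, and let $(\mathcal L_{p,\infty})_0(H)$ be the set of all $T\in\mathcal L_{p,\infty}(H)$ with $\lim_{n\to\infty}(n+1)^{1/p}\mu(n,T)=0$. Powers of positive operators are taken in the sense of the functional calculus, and $[X,Y]=XY-YX$. Theorem. Let $q>0$, let $0\le A$ be a bounded operator on $H$ and let $0\le B\in\mathcal L_{q,\infty}(H)$. Suppose that $$[A^{\epsilon},B^{\delta}]\in(\mathcal L_{q/\delta,\infty})_0(H)\qquad\text{for all }\epsilon,\delta>0.$$ Then $$B^sA^s-\bigl(A^{1/2}BA^{1/2}\bigr)^s\in(\mathcal L_{q/s,\infty})_0(H)\qquad\text{for every } s>0.$$ -/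

import Mathlib

/-- The `n`-th singular value `μ(n, T) = inf {‖T - R‖ : Rank R ≤ n}` of a bounded operator `T`
on a complex Hilbert space (zero-indexed, so that `μ(0, T) = ‖T‖`). The rank is a cardinal, so
that only operators of finite rank compete. -/
noncomputable def singularValue {H : Type*} [NormedAddCommGroup H] [InnerProductSpace ℂ H]
    (n : ℕ) (T : H →L[ℂ] H) : ℝ :=
  sInf {r : ℝ | ∃ R : H →L[ℂ] H, (R : H →ₗ[ℂ] H).rank ≤ (n : Cardinal) ∧ r = ‖T - R‖}

/-- The weak Schatten ideal `𝓛_{p,∞}(H)`, for `0 < p < ∞`: all compact operators `T` with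
`sup_{n ≥ 0} (n + 1)^{1/p} μ(n, T) < ∞`. -/
def weakSchatten (H : Type*) [NormedAddCommGroup H] [InnerProductSpace ℂ H] (p : ℝ) :
    Set (H →L[ℂ] H) :=
  {T | IsCompactOperator T ∧
    BddAbove (Set.range fun n : ℕ => ((n : ℝ) + 1) ^ (1 / p) * singularValue n T)}

/-- The separable part `(𝓛_{p,∞})₀(H)` of `𝓛_{p,∞}(H)`: all `T ∈ 𝓛_{p,∞}(H)` with
`lim_{n → ∞} (n + 1)^{1/p} μ(n, T) = 0`. -/
def weakSchattenSeparablePart (H : Type*) [NormedAddCommGroup H] [InnerProductSpace ℂ H]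
    (p : ℝ) : Set (H →L[ℂ] H) :=
  {T | T ∈ weakSchatten H p ∧
    Filter.Tendsto (fun n : ℕ => ((n : ℝ) + 1) ^ (1 / p) * singularValue n T)
      Filter.atTop (nhds 0)}

/-!
The proof transfers the statement to commuting operators by measuring operators with the traces
`Tr / n`. A sequence `T n` of bounded operators is *null in measure* if, for every `ε > 0`, it is
eventually within distance `ε` of an operator of rank at most `ε * n`; it is *bounded in measure*
if, for every `ε > 0`, there is an `M` such that it is eventually within distance `M` of an operator
of rank at most `ε * n`. Null sequences form an ideal among the bounded ones. An operator `T` lies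
in `(𝓛_{p,∞})₀` exactly when the sequence `n ^ (1 / p) • T` is null in measure
(`nullInMeasure_of_mem_separablePart`, `mem_separablePart_of_nullInMeasure`), and the sequence
`n ^ (1 / q) • B` is bounded in measure for `B ∈ 𝓛_{q,∞}`. Since
`(n ^ (1 / q) • B) ^ δ = n ^ (δ / q) • B ^ δ`, the hypothesis says that the powers of `A` and of
`b n = n ^ (1 / q) • B` commute up to null sequences, and the claim is that `b n ^ s * A ^ s` and
`(A ^ (1 / 2) * b n * A ^ (1 / 2)) ^ s` agree up to a null sequence.

The analytic input is that the continuous functional calculus of positive operators is continuous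
in measure (`EqInMeasure.cfc`): a sequence which is bounded in measure has, up to small rank, its
spectrum in a fixed interval, and there a continuous function is uniformly close to a polynomial.

For a rational exponent `s = k / m` put `Y n = A ^ (1 / 2m) * b n ^ (1 / m) * A ^ (1 / 2m)`.
Commuting factors gives `Y n ^ j = b n ^ (j / m) * A ^ (j / m)` up to null sequences, so `Y n ^ m`
agrees with `A ^ (1 / 2) * b n * A ^ (1 / 2)`. Taking the power `k / m` of both, by continuity of
the functional calculus, `Y n ^ k` agrees with `(A ^ (1 / 2) * b n * A ^ (1 / 2)) ^ s`, and it also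
agrees with `b n ^ s * A ^ s`. A general `s` is approximated by rational exponents, because powers
depend continuously on the exponent, uniformly on bounded intervals.
-/

open Filter Topology

/-! ### Approximation by operators of finite rank -/

section Operators

variable {H : Type*} [NormedAddCommGroup H] [InnerProductSpace ℂ H]

/-- `T` lies within operator-norm distance `c` of an operator of rank at most `r`. The bound `r`
is real, so that rank budgets of the form `ε * n` need no rounding. -/
def IsApproxByRank (r c : ℝ) (T : H →L[ℂ] H) : Prop :=
  ∃ (R : H →L[ℂ] H) (k : ℕ), (R : H →ₗ[ℂ] H).rank ≤ (k : Cardinal) ∧ (k : ℝ) ≤ r ∧ ‖T - R‖ ≤ c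

namespace IsApproxByRank

variable {r r' c c' : ℝ} {T T' : H →L[ℂ] H}

lemma nonneg (h : IsApproxByRank r c T) : 0 ≤ c := by
  obtain ⟨R, k, -, -, h⟩ := h
  exact (norm_nonneg _).trans h

lemma mono (h : IsApproxByRank r c T) (hr : r ≤ r') (hc : c ≤ c') : IsApproxByRank r' c' T := by
  obtain ⟨R, k, h1, h2, h3⟩ := h
  exact ⟨R, k, h1, h2.trans hr, h3.trans hc⟩

lemma of_norm_le (hr : 0 ≤ r) (h : ‖T‖ ≤ c) : IsApproxByRank r c T := by
  refine ⟨0, 0, ?_, by simpa using hr, by simpa using h⟩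
  simp [LinearMap.rank]

lemma of_rank_le {k : ℕ} (h : (T : H →ₗ[ℂ] H).rank ≤ (k : Cardinal)) (hr : (k : ℝ) ≤ r) :
    IsApproxByRank r 0 T :=
  ⟨T, k, h, hr, by simp⟩

lemma add (h : IsApproxByRank r c T) (h' : IsApproxByRank r' c' T') :
    IsApproxByRank (r + r') (c + c') (T + T') := by
  obtain ⟨R, k, h1, h2, h3⟩ := h
  obtain ⟨R', k', h1', h2', h3'⟩ := h'
  refine ⟨R + R', k + k', ?_, by push_cast; linarith, ?_⟩
  · push_cast
    exact (LinearMap.rank_add_le _ _).trans (add_le_add h1 h1')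
  · rw [add_sub_add_comm]
    exact (norm_add_le _ _).trans (add_le_add h3 h3')

lemma smul (a : ℝ) (h : IsApproxByRank r c T) : IsApproxByRank r (|a| * c) (a • T) := by
  obtain ⟨R, k, h1, h2, h3⟩ := h
  refine ⟨a • R, k, ?_, h2, ?_⟩
  · refine le_trans ?_ h1
    have : ((a • R : H →L[ℂ] H) : H →ₗ[ℂ] H) =
        (R : H →ₗ[ℂ] H).comp ((a • (1 : H →L[ℂ] H) : H →L[ℂ] H) : H →ₗ[ℂ] H) := by
      ext x; simp
    rw [this]
    exact LinearMap.rank_comp_le_left _ _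
  · rw [← smul_sub, norm_smul, Real.norm_eq_abs]
    gcongr

lemma neg (h : IsApproxByRank r c T) : IsApproxByRank r c (-T) := by
  simpa using h.smul (-1)

lemma sub (h : IsApproxByRank r c T) (h' : IsApproxByRank r' c' T') :
    IsApproxByRank (r + r') (c + c') (T - T') := by
  simpa [sub_eq_add_neg] using h.add h'.neg

/-- With `T = R + E` and `T' = R' + E'`, the product is `R T' + E R'` up to the small term
`E E'`. -/
lemma mul (h : IsApproxByRank r c T) (h' : IsApproxByRank r' c' T') :
    IsApproxByRank (r + r') (c * c') (T * T') := by
  have hc := h.nonneg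
  obtain ⟨R, k, h1, h2, h3⟩ := h
  obtain ⟨R', k', h1', h2', h3'⟩ := h'
  refine ⟨R * T' + (T - R) * R', k + k', ?_, by push_cast; linarith, ?_⟩
  · push_cast
    refine (LinearMap.rank_add_le _ _).trans (add_le_add ?_ ?_)
    · exact (LinearMap.rank_comp_le_left (T' : H →ₗ[ℂ] H) (R : H →ₗ[ℂ] H)).trans h1
    · exact (LinearMap.rank_comp_le_right (R' : H →ₗ[ℂ] H) ((T - R : H →L[ℂ] H) : H →ₗ[ℂ] H)).trans
        h1'
  · have : T * T' - (R * T' + (T - R) * R') = (T - R) * (T' - R') := by noncomm_ring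
    rw [this]
    exact (norm_mul_le _ _).trans (mul_le_mul h3 h3' (norm_nonneg _) hc)

end IsApproxByRank

/-! ### Sequences that are null or bounded in measure -/

/-- The sequence `T n` tends to zero in measure, with respect to the trace on `B(H)` divided by
`n`: up to rank `ε * n` and norm `ε` it is eventually zero, for every `ε`. -/
def NullInMeasure (T : ℕ → H →L[ℂ] H) : Prop :=
  ∀ ε > 0, ∀ᶠ n : ℕ in atTop, IsApproxByRank (ε * n) ε (T n)

/-- The sequence `T n` is bounded in measure, with respect to the trace on `B(H)` divided by `n`:
up to rank `ε * n` it is eventually bounded in norm, for every `ε`. -/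
def BoundedInMeasure (T : ℕ → H →L[ℂ] H) : Prop :=
  ∀ ε > 0, ∃ M : ℝ, ∀ᶠ n : ℕ in atTop, IsApproxByRank (ε * n) M (T n)

variable {S T U : ℕ → H →L[ℂ] H}

lemma NullInMeasure.add (hS : NullInMeasure S) (hT : NullInMeasure T) :
    NullInMeasure (fun n => S n + T n) := by
  intro ε hε
  filter_upwards [hS (ε / 2) (by positivity), hT (ε / 2) (by positivity)] with n h1 h2
  exact (h1.add h2).mono (by linarith) (by linarith)

lemma NullInMeasure.neg (hT : NullInMeasure T) : NullInMeasure (fun n => -T n) := by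
  intro ε hε
  filter_upwards [hT ε hε] with n h
  exact h.neg

lemma NullInMeasure.zero : NullInMeasure (fun _ => (0 : H →L[ℂ] H)) := by
  intro ε hε
  exact Eventually.of_forall fun n =>
    IsApproxByRank.of_norm_le (by positivity) (by simpa using hε.le)

lemma BoundedInMeasure.const (A : H →L[ℂ] H) : BoundedInMeasure (fun _ => A) :=
  fun ε hε => ⟨‖A‖, Eventually.of_forall fun n =>
    IsApproxByRank.of_norm_le (by positivity) le_rfl⟩

lemma BoundedInMeasure.mul (hS : BoundedInMeasure S) (hT : BoundedInMeasure T) :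
    BoundedInMeasure (fun n => S n * T n) := by
  intro ε hε
  obtain ⟨M, hM⟩ := hS (ε / 2) (by positivity)
  obtain ⟨N, hN⟩ := hT (ε / 2) (by positivity)
  refine ⟨M * N, ?_⟩
  filter_upwards [hM, hN] with n h1 h2
  exact (h1.mul h2).mono (by linarith) le_rfl

lemma BoundedInMeasure.pow (hT : BoundedInMeasure T) (k : ℕ) :
    BoundedInMeasure (fun n => T n ^ k) := by
  induction k with
  | zero => simpa using BoundedInMeasure.const (1 : H →L[ℂ] H)
  | succ k ih => simpa only [pow_succ] using ih.mul hT

lemma NullInMeasure.mul_bounded (hS : NullInMeasure S) (hT : BoundedInMeasure T) :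
    NullInMeasure (fun n => S n * T n) := by
  intro ε hε
  obtain ⟨M, hM⟩ := hT (ε / 2) (by positivity)
  have hd : 0 < min (ε / 2) (ε / max M 1) := by positivity
  filter_upwards [hM, hS _ hd] with n h1 h2
  refine (h2.mul h1).mono ?_ ?_
  · have := mul_le_mul_of_nonneg_right (min_le_left (ε / 2) (ε / max M 1)) n.cast_nonneg
    linarith
  · calc min (ε / 2) (ε / max M 1) * M ≤ (ε / max M 1) * max M 1 :=
          mul_le_mul (min_le_right _ _) (le_max_left _ _) h1.nonneg (by positivity)
      _ = ε := by field_simp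

lemma BoundedInMeasure.mul_null (hT : BoundedInMeasure T) (hS : NullInMeasure S) :
    NullInMeasure (fun n => T n * S n) := by
  intro ε hε
  obtain ⟨M, hM⟩ := hT (ε / 2) (by positivity)
  have hd : 0 < min (ε / 2) (ε / max M 1) := by positivity
  filter_upwards [hM, hS _ hd] with n h1 h2
  refine (h1.mul h2).mono ?_ ?_
  · have := mul_le_mul_of_nonneg_right (min_le_left (ε / 2) (ε / max M 1)) n.cast_nonneg
    linarith
  · calc M * min (ε / 2) (ε / max M 1) ≤ max M 1 * (ε / max M 1) :=
          mul_le_mul (le_max_left _ _) (min_le_right _ _) hd.le (by positivity)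
      _ = ε := by field_simp

/-- Equality of two sequences in the limit in measure. -/
def EqInMeasure (S T : ℕ → H →L[ℂ] H) : Prop :=
  NullInMeasure (fun n => S n - T n)

lemma EqInMeasure.refl (S : ℕ → H →L[ℂ] H) : EqInMeasure S S := by
  simpa [EqInMeasure] using NullInMeasure.zero

lemma EqInMeasure.symm (h : EqInMeasure S T) : EqInMeasure T S := by
  simpa [EqInMeasure] using NullInMeasure.neg h

lemma EqInMeasure.trans (h : EqInMeasure S T) (h' : EqInMeasure T U) : EqInMeasure S U := by
  simpa [EqInMeasure] using NullInMeasure.add h h'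

lemma EqInMeasure.mul_right (h : EqInMeasure S T) (hU : BoundedInMeasure U) :
    EqInMeasure (fun n => S n * U n) (fun n => T n * U n) := by
  simpa only [EqInMeasure, sub_mul] using NullInMeasure.mul_bounded h hU

lemma EqInMeasure.mul_left (hU : BoundedInMeasure U) (h : EqInMeasure S T) :
    EqInMeasure (fun n => U n * S n) (fun n => U n * T n) := by
  simpa only [EqInMeasure, mul_sub] using BoundedInMeasure.mul_null hU h

lemma EqInMeasure.mul {S' T' : ℕ → H →L[ℂ] H} (h : EqInMeasure S T) (h' : EqInMeasure S' T')
    (hS' : BoundedInMeasure S') (hT : BoundedInMeasure T) :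
    EqInMeasure (fun n => S n * S' n) (fun n => T n * T' n) :=
  (h.mul_right hS').trans (.mul_left hT h')

lemma EqInMeasure.add {S' T' : ℕ → H →L[ℂ] H} (h : EqInMeasure S T) (h' : EqInMeasure S' T') :
    EqInMeasure (fun n => S n + S' n) (fun n => T n + T' n) := by
  simpa only [EqInMeasure, add_sub_add_comm] using NullInMeasure.add h h'

lemma EqInMeasure.pow (h : EqInMeasure S T) (hS : BoundedInMeasure S) (hT : BoundedInMeasure T)
    (k : ℕ) : EqInMeasure (fun n => S n ^ k) (fun n => T n ^ k) := by
  induction k with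
  | zero => simpa using EqInMeasure.refl _
  | succ k ih =>
    simp only [pow_succ]
    exact (ih.mul_right hS).trans (EqInMeasure.mul_left (hT.pow k) h)

lemma EqInMeasure.aeval (h : EqInMeasure S T) (hS : BoundedInMeasure S) (hT : BoundedInMeasure T)
    (p : Polynomial ℝ) :
    EqInMeasure (fun n => Polynomial.aeval (S n) p) (fun n => Polynomial.aeval (T n) p) := by
  induction p using Polynomial.induction_on' with
  | add p q hp hq => simpa only [map_add] using hp.add hq
  | monomial k a =>
    simp only [Polynomial.aeval_monomial]
    exact EqInMeasure.mul_left (.const (algebraMap ℝ (H →L[ℂ] H) a)) (h.pow hS hT k)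

/-! ### The weak Schatten ideals in terms of rescaled constant sequences -/

lemma singularValue_le {n : ℕ} {c : ℝ} {T : H →L[ℂ] H} (h : IsApproxByRank n c T) :
    singularValue n T ≤ c := by
  obtain ⟨R, k, h1, h2, h3⟩ := h
  have hbdd : BddBelow {r : ℝ | ∃ R : H →L[ℂ] H, (R : H →ₗ[ℂ] H).rank ≤ (n : Cardinal) ∧
      r = ‖T - R‖} := ⟨0, by rintro _ ⟨R, -, rfl⟩; exact norm_nonneg _⟩
  exact (csInf_le hbdd ⟨R, h1.trans (by exact_mod_cast h2), rfl⟩).trans h3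

lemma singularValue_nonneg (n : ℕ) (T : H →L[ℂ] H) : 0 ≤ singularValue n T :=
  Real.sInf_nonneg (by rintro _ ⟨R, -, rfl⟩; exact norm_nonneg _)

lemma isApproxByRank_of_singularValue_lt {n : ℕ} {c : ℝ} {T : H →L[ℂ] H}
    (h : singularValue n T < c) : IsApproxByRank n c T := by
  have hne : {r : ℝ | ∃ R : H →L[ℂ] H, (R : H →ₗ[ℂ] H).rank ≤ (n : Cardinal) ∧
      r = ‖T - R‖}.Nonempty := ⟨‖T - 0‖, 0, by simp [LinearMap.rank], rfl⟩
  obtain ⟨_, ⟨R, h1, rfl⟩, h2⟩ := exists_lt_of_csInf_lt hne h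
  exact ⟨R, n, h1, le_rfl, h2.le⟩

lemma isCompactOperator_of_rank_le {k : ℕ} {R : H →L[ℂ] H}
    (h : (R : H →ₗ[ℂ] H).rank ≤ (k : Cardinal)) : IsCompactOperator R := by
  have hfin : FiniteDimensional ℂ (LinearMap.range (R : H →ₗ[ℂ] H)) :=
    Module.rank_lt_aleph0_iff.1 (h.trans_lt (Cardinal.natCast_lt_aleph0))
  have : IsCompactOperator (R.codRestrict (LinearMap.range (R : H →ₗ[ℂ] H)) fun x => ⟨x, rfl⟩) :=
    haveI : ProperSpace (LinearMap.range (R : H →ₗ[ℂ] H)) := FiniteDimensional.proper ℂ _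
    isCompactOperator_of_locallyCompactSpace_dom _
  exact this.clm_comp (LinearMap.range (R : H →ₗ[ℂ] H)).subtypeL

/-- A bound on the weighted singular value at the index `⌊ε * n⌋` is a bound in measure on the
`n`-th term of the rescaled sequence, because `n ≤ ε⁻¹ * (⌊ε * n⌋ + 1)`. -/
lemma isApproxByRank_rescaled {p ε c : ℝ} (hp : 0 < p) (hε : 0 < ε) {n : ℕ} {T : H →L[ℂ] H}
    (h : ((⌊ε * n⌋₊ : ℝ) + 1) ^ (1 / p) * singularValue ⌊ε * n⌋₊ T < c) :
    IsApproxByRank (ε * n) (ε⁻¹ ^ (1 / p) * c) ((n : ℝ) ^ (1 / p) • T) := by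
  set m := ⌊ε * n⌋₊
  have hm : ((m : ℝ) + 1) ^ (1 / p) > 0 := by positivity
  have h1 := isApproxByRank_of_singularValue_lt ((lt_div_iff₀' hm).2 h)
  have hc : 0 ≤ c := (mul_nonneg hm.le (singularValue_nonneg _ _)).trans h.le
  refine (h1.smul ((n : ℝ) ^ (1 / p))).mono (Nat.floor_le (by positivity)) ?_
  have h2 : (n : ℝ) ≤ ε⁻¹ * ((m : ℝ) + 1) := by
    have := (Nat.lt_floor_add_one (ε * n)).le
    rw [inv_mul_eq_div, le_div_iff₀' hε]
    exact this
  have h3 : (n : ℝ) ^ (1 / p) ≤ ε⁻¹ ^ (1 / p) * ((m : ℝ) + 1) ^ (1 / p) := by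
    rw [← Real.mul_rpow (by positivity) (by positivity)]
    exact Real.rpow_le_rpow (by positivity) h2 (by positivity)
  rw [abs_of_nonneg (by positivity)]
  calc _ ≤ ε⁻¹ ^ (1 / p) * ((m : ℝ) + 1) ^ (1 / p) * (c / ((m : ℝ) + 1) ^ (1 / p)) := by gcongr
    _ = _ := by field_simp

lemma boundedInMeasure_of_mem_weakSchatten {p : ℝ} (hp : 0 < p) {T : H →L[ℂ] H}
    (h : T ∈ weakSchatten H p) : BoundedInMeasure (fun n : ℕ => (n : ℝ) ^ (1 / p) • T) := by
  obtain ⟨C, hC⟩ := h.2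
  exact fun ε hε => ⟨ε⁻¹ ^ (1 / p) * (C + 1), Eventually.of_forall fun n =>
    isApproxByRank_rescaled hp hε ((hC (Set.mem_range_self _)).trans_lt (lt_add_one C))⟩

lemma nullInMeasure_of_mem_separablePart {p : ℝ} (hp : 0 < p) {T : H →L[ℂ] H}
    (h : T ∈ weakSchattenSeparablePart H p) :
    NullInMeasure (fun n : ℕ => (n : ℝ) ^ (1 / p) • T) := by
  intro ε hε
  have hc : 0 < ε / ε⁻¹ ^ (1 / p) := by positivity
  have hfl : Tendsto (fun n : ℕ => ⌊ε * n⌋₊) atTop atTop :=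
    tendsto_nat_floor_atTop.comp (tendsto_natCast_atTop_atTop.const_mul_atTop hε)
  filter_upwards [(h.2.comp hfl).eventually_lt_const hc] with n hn
  refine (isApproxByRank_rescaled hp hε hn).mono le_rfl (le_of_eq ?_)
  field_simp

/-- The estimate at `n + 1` with rank budget `(n + 1) / 2 ≤ n` bounds the `n`-th singular value.
Compactness of `T` is part of the conclusion: the same estimates exhibit `T` as a norm limit of
operators of finite rank. -/
lemma mem_separablePart_of_nullInMeasure [CompleteSpace H] {p : ℝ} (hp : 0 < p) {T : H →L[ℂ] H}
    (h : NullInMeasure (fun n : ℕ => (n : ℝ) ^ (1 / p) • T)) :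
    T ∈ weakSchattenSeparablePart H p := by
  have key : ∀ ε > 0, ∀ᶠ n : ℕ in atTop,
      IsApproxByRank n (ε / ((n : ℝ) + 1) ^ (1 / p)) T := by
    intro ε hε
    have hδ : 0 < min ε (1 / 2) := by positivity
    filter_upwards [(tendsto_add_atTop_nat 1).eventually (h _ hδ), eventually_ge_atTop 1]
      with n hn hn1
    have hn1' : (1 : ℝ) ≤ n := by exact_mod_cast hn1
    have hpos : 0 < ((n : ℝ) + 1) ^ (1 / p) := by positivity
    have := hn.smul (((n : ℝ) + 1) ^ (1 / p))⁻¹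
    push_cast at this
    rw [smul_smul, inv_mul_cancel₀ hpos.ne', one_smul, abs_of_pos (by positivity)] at this
    refine this.mono ?_ ?_
    · have := min_le_right ε (1 / 2)
      nlinarith
    · rw [inv_mul_eq_div]
      gcongr
      exact min_le_left _ _
  have hlim : Tendsto (fun n : ℕ => ((n : ℝ) + 1) ^ (1 / p) * singularValue n T) atTop (𝓝 0) := by
    refine tendsto_order.2 ⟨fun a ha => Eventually.of_forall fun n => ha.trans_le
      (mul_nonneg (by positivity) (singularValue_nonneg _ _)), fun a ha => ?_⟩
    filter_upwards [key (a / 2) (by positivity)] with n hn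
    have hpos : 0 < ((n : ℝ) + 1) ^ (1 / p) := by positivity
    have := (le_div_iff₀' hpos).1 (singularValue_le hn)
    linarith
  refine ⟨⟨?_, hlim.bddAbove_range⟩, hlim⟩
  have hcl : T ∈ closure {S : H →L[ℂ] H | IsCompactOperator S} := by
    refine Metric.mem_closure_iff.2 fun ε hε => ?_
    obtain ⟨n, R, k, h1, -, h3⟩ := (key (ε / 2) (by positivity)).exists
    refine ⟨R, isCompactOperator_of_rank_le h1, ?_⟩
    rw [dist_eq_norm]
    have : (1 : ℝ) ≤ ((n : ℝ) + 1) ^ (1 / p) := Real.one_le_rpow (by simp) (by positivity)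
    exact (h3.trans (div_le_self (by positivity) this)).trans_lt (by linarith)
  rwa [(isClosed_setOfPred_isCompactOperator (σ₁₂ := RingHom.id ℂ) (M₁ := H)
    (M₂ := H)).closure_eq] at hcl

end Operators

/-! ### Functional calculus in measure -/

section FunctionalCalculus

variable {H : Type*} [NormedAddCommGroup H] [InnerProductSpace ℂ H] [CompleteSpace H]

/-- The spectral subspace of `X` above the level `M' > M` has dimension at most `k` if `X` lies
within distance `M` of an operator `R` of rank at most `k`: on that subspace `X` is at least `M'`,
so `R` is injective there. -/
lemma rank_cfc_le {X R : H →L[ℂ] H} (hX : 0 ≤ X) {k : ℕ} {M M' : ℝ}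
    (hR : (R : H →ₗ[ℂ] H).rank ≤ (k : Cardinal)) (hXR : ‖X - R‖ ≤ M) (hM : M < M')
    {g : ℝ → ℝ} (hg : Continuous g) (hg0 : ∀ x ≤ M', g x = 0) :
    ((cfc g X : H →L[ℂ] H) : H →ₗ[ℂ] H).rank ≤ (k : Cardinal) := by
  have hsa : IsSelfAdjoint X := .of_nonneg hX
  set G := cfc g X with hG
  have hGsa : IsSelfAdjoint G := cfc_predicate g X
  have hpos : 0 ≤ G * (X - algebraMap ℝ (H →L[ℂ] H) M') * G := by
    have : G * (X - algebraMap ℝ (H →L[ℂ] H) M') * G = cfc (fun x => g x * (x - M') * g x) X := by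
      rw [cfc_mul (fun x => g x * (x - M')) g X, cfc_mul g (fun x => x - M') X,
        cfc_sub (fun x => x) (fun _ => M') X, cfc_id' ℝ X, cfc_const M' X]
    rw [this]
    refine cfc_nonneg fun x _ => ?_
    rcases le_total x M' with h | h
    · simp [hg0 x h]
    · nlinarith [mul_nonneg (mul_self_nonneg (g x)) (sub_nonneg.2 h)]
  have hinj : ∀ w, R (G w) = 0 → G w = 0 := by
    intro w hw
    have h1 := ((ContinuousLinearMap.nonneg_iff_isPositive _).1 hpos).re_inner_nonneg_left w
    have h2 : G * (X - algebraMap ℝ (H →L[ℂ] H) M') * G =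
        ContinuousLinearMap.adjoint G * (X - algebraMap ℝ (H →L[ℂ] H) M') * G := by
      rw [← ContinuousLinearMap.star_eq_adjoint, hGsa.star_eq]
    rw [h2] at h1
    simp only [mul_apply_eq_comp, ContinuousLinearMap.adjoint_inner_left,
      sub_apply, inner_sub_left, map_sub, Algebra.algebraMap_eq_smul_one,
      smul_apply, one_apply_eq_self] at h1
    have h3 : RCLike.re (inner ℂ (M' • G w) (G w)) = M' * ‖G w‖ ^ 2 := by
      rw [← Complex.coe_smul, inner_smul_left, inner_self_eq_norm_sq_to_K]
      simp [← Complex.ofReal_pow]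
    have h4 : RCLike.re (inner ℂ (X (G w)) (G w)) ≤ M * ‖G w‖ ^ 2 := by
      have : X (G w) = (X - R) (G w) := by simp [hw]
      rw [this]
      calc _ ≤ ‖(X - R) (G w)‖ * ‖G w‖ := re_inner_le_norm _ _
        _ ≤ M * ‖G w‖ * ‖G w‖ := by gcongr; exact (X - R).le_of_opNorm_le hXR _
        _ = _ := by ring
    have h5 : ‖G w‖ ^ 2 ≤ 0 := by
      by_contra! h
      nlinarith
    simpa using h5
  refine le_trans ?_ hR
  let f : LinearMap.range (G : H →ₗ[ℂ] H) →ₗ[ℂ] LinearMap.range (R : H →ₗ[ℂ] H) :=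
    ((R : H →ₗ[ℂ] H).domRestrict _).codRestrict _ fun x => ⟨x, rfl⟩
  refine LinearMap.rank_le_of_injective f ((injective_iff_map_eq_zero f).2 ?_)
  rintro ⟨_, w, rfl⟩ h
  exact Subtype.ext (hinj w (congrArg Subtype.val h))

/-- Values of `u` above the level `M'` change `cfc u X` by an operator of small rank only. -/
lemma IsApproxByRank.cfc {X : H →L[ℂ] H} (hX : 0 ≤ X) {r M M' ε : ℝ} (h : IsApproxByRank r M X)
    (hM : M < M') {u : ℝ → ℝ} (hu : Continuous u) (huε : ∀ x ∈ Set.Icc 0 M', |u x| ≤ ε) :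
    IsApproxByRank r ε (cfc u X) := by
  have hM0 : 0 ≤ M' := h.nonneg.trans hM.le
  have hε : 0 ≤ ε := (abs_nonneg _).trans (huε 0 ⟨le_rfl, hM0⟩)
  have hsa : IsSelfAdjoint X := .of_nonneg hX
  obtain ⟨R, k, h1, h2, h3⟩ := h
  have hv : Continuous fun x => u (min x M') := by fun_prop
  have htail := rank_cfc_le hX h1 h3 hM (g := fun x => u x - u (min x M')) (hu.sub hv)
    fun x hx => by simp [min_eq_left hx]
  have hsum : _root_.cfc u X =
      _root_.cfc (fun x => u x - u (min x M')) X + _root_.cfc (fun x => u (min x M')) X := by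
    rw [← cfc_add (R := ℝ) ..]
    simp
  have hnorm : ‖_root_.cfc (fun x => u (min x M')) X‖ ≤ ε := by
    refine norm_cfc_le hε fun x hx => huε _ ⟨le_min ?_ hM0, min_le_right _ _⟩
    exact spectrum_nonneg_of_nonneg hX hx
  rw [hsum]
  simpa using (IsApproxByRank.of_rank_le htail h2).add (IsApproxByRank.of_norm_le le_rfl hnorm)

variable {X Z : ℕ → H →L[ℂ] H}

lemma BoundedInMeasure.cfc (hX : ∀ n, 0 ≤ X n) (hXb : BoundedInMeasure X) {u : ℝ → ℝ}
    (hu : Continuous u) : BoundedInMeasure (fun n => cfc u (X n)) := by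
  intro ε hε
  obtain ⟨M, hM⟩ := hXb ε hε
  obtain ⟨C, hC⟩ := (isCompact_Icc (a := (0 : ℝ)) (b := M + 1)).exists_bound_of_continuousOn
    hu.continuousOn
  exact ⟨C, hM.mono fun n hn => hn.cfc (hX n) (lt_add_one M) hu hC⟩

/-- The continuous functional calculus is continuous in measure. For a polynomial this is algebra;
a general function is uniformly close to a polynomial on the interval that carries all of the
spectrum up to small rank. -/
lemma EqInMeasure.cfc (hX : ∀ n, 0 ≤ X n) (hZ : ∀ n, 0 ≤ Z n) (hXb : BoundedInMeasure X)
    (hZb : BoundedInMeasure Z) (h : EqInMeasure X Z) {u : ℝ → ℝ} (hu : Continuous u) :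
    EqInMeasure (fun n => cfc u (X n)) (fun n => cfc u (Z n)) := by
  intro ε hε
  have hε4 : 0 < ε / 4 := by positivity
  obtain ⟨M, hM⟩ := hXb (ε / 4) hε4
  obtain ⟨N, hN⟩ := hZb (ε / 4) hε4
  obtain ⟨p, hp⟩ := exists_polynomial_near_of_continuousOn 0 (max M N + 1) u hu.continuousOn
    (ε / 4) hε4
  have hd : Continuous fun x => u x - p.eval x := hu.sub p.continuous
  have hdε : ∀ x ∈ Set.Icc 0 (max M N + 1), |u x - p.eval x| ≤ ε / 4 := fun x hx => by
    rw [abs_sub_comm]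
    exact (hp x hx).le
  have hsplit : ∀ T : H →L[ℂ] H, 0 ≤ T →
      _root_.cfc (fun x => u x - p.eval x) T = _root_.cfc u T - Polynomial.aeval T p := by
    intro T hT
    have hsa : IsSelfAdjoint T := .of_nonneg hT
    rw [cfc_sub u (fun x => p.eval x) T (by fun_prop) p.continuous.continuousOn,
      cfc_polynomial p T]
  filter_upwards [hM, hN, h.aeval hXb hZb p (ε / 2) (by positivity)] with n h1 h2 h3
  have e1 := h1.cfc (hX n) (lt_of_le_of_lt (le_max_left M N) (lt_add_one _)) hd hdε
  have e2 := h2.cfc (hZ n) (lt_of_le_of_lt (le_max_right M N) (lt_add_one _)) hd hdε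
  rw [hsplit _ (hX n)] at e1
  rw [hsplit _ (hZ n)] at e2
  have := (e1.add h3).sub e2
  convert this.mono (r' := ε * n) (c' := ε) (by linarith) (by linarith) using 1
  abel

/-! ### Real powers -/

lemma rpow_add_of_pos {a : H →L[ℂ] H} (ha : 0 ≤ a) {x y : ℝ} (hx : 0 < x) (hy : 0 < y) :
    a ^ (x + y) = a ^ x * a ^ y := by
  have hsa : IsSelfAdjoint a := .of_nonneg ha
  have hxc := Real.continuous_rpow_const hx.le
  have hyc := Real.continuous_rpow_const hy.le
  rw [CFC.rpow_eq_cfc_real, CFC.rpow_eq_cfc_real, CFC.rpow_eq_cfc_real,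
    ← cfc_mul _ _ a hxc.continuousOn hyc.continuousOn]
  exact cfc_congr fun t ht =>
    Real.rpow_add_of_nonneg (spectrum_nonneg_of_nonneg ha ht) hx.le hy.le

lemma real_smul_rpow {a : H →L[ℂ] H} (ha : 0 ≤ a) {c s : ℝ} (hc : 0 ≤ c) (hs : 0 < s) :
    (c • a) ^ s = c ^ s • a ^ s := by
  have hsa : IsSelfAdjoint a := .of_nonneg ha
  have hsc := Real.continuous_rpow_const hs.le
  rw [CFC.rpow_eq_cfc_real (smul_nonneg hc ha), CFC.rpow_eq_cfc_real,
    ← cfc_comp_const_mul c (fun x : ℝ => x ^ s) a hsc.continuousOn,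
    ← cfc_smul (c ^ s) (fun x : ℝ => x ^ s) a hsc.continuousOn]
  exact cfc_congr fun t ht => by
    simpa using Real.mul_rpow hc (spectrum_nonneg_of_nonneg ha ht)

lemma BoundedInMeasure.rpow (hX : ∀ n, 0 ≤ X n) (hXb : BoundedInMeasure X) {s : ℝ} (hs : 0 < s) :
    BoundedInMeasure (fun n => X n ^ s) := by
  simpa only [CFC.rpow_eq_cfc_real (hX _)] using hXb.cfc hX (Real.continuous_rpow_const hs.le)

lemma EqInMeasure.rpow (hX : ∀ n, 0 ≤ X n) (hZ : ∀ n, 0 ≤ Z n) (hXb : BoundedInMeasure X)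
    (hZb : BoundedInMeasure Z) (h : EqInMeasure X Z) {s : ℝ} (hs : 0 < s) :
    EqInMeasure (fun n => X n ^ s) (fun n => Z n ^ s) := by
  simpa only [CFC.rpow_eq_cfc_real (hX _), CFC.rpow_eq_cfc_real (hZ _)] using
    EqInMeasure.cfc hX hZ hXb hZb h (Real.continuous_rpow_const hs.le)

/-- Powers depend continuously on the exponent, in measure. -/
lemma BoundedInMeasure.eventually_rpow_sub_rpow (hX : ∀ n, 0 ≤ X n) (hXb : BoundedInMeasure X)
    {s ε : ℝ} (hs : 0 < s) (hε : 0 < ε) :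
    ∀ᶠ t in 𝓝 s, ∀ᶠ n : ℕ in atTop, IsApproxByRank (ε * n) ε (X n ^ s - X n ^ t) := by
  obtain ⟨M, hM⟩ := hXb ε hε
  have hcont : ContinuousOn (Function.uncurry fun t x : ℝ => x ^ t)
      (Set.Ioi 0 ×ˢ Set.Icc 0 (M + 1)) := by
    rintro ⟨t, x⟩ ⟨ht, -⟩
    exact (ContinuousAt.comp (f := Prod.swap) (x := (t, x))
      (Real.continuousAt_rpow (x, t) (Or.inr ht))
      continuous_swap.continuousAt).continuousWithinAt
  obtain ⟨v, hv, hv'⟩ := isCompact_Icc.mem_uniformity_of_prod hcont (Set.mem_Ioi.2 hs)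
    (Metric.dist_mem_uniformity hε)
  rw [(isOpen_Ioi).nhdsWithin_eq (Set.mem_Ioi.2 hs)] at hv
  filter_upwards [hv, eventually_gt_nhds hs] with t ht ht0
  filter_upwards [hM] with n hn
  have hsc := Real.continuous_rpow_const hs.le
  have htc := Real.continuous_rpow_const ht0.le
  rw [CFC.rpow_eq_cfc_real (hX n), CFC.rpow_eq_cfc_real (hX n),
    ← cfc_sub _ _ (X n) hsc.continuousOn htc.continuousOn]
  refine hn.cfc (hX n) (lt_add_one M) (hsc.sub htc) fun x hx => ?_
  have : dist (x ^ t) (x ^ s) < ε := hv' t ht x hx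
  rw [abs_sub_comm]
  exact this.le

end FunctionalCalculus

/-! ### Powers of asymptotically commuting positive sequences -/

section Commuting

variable {H : Type*} [NormedAddCommGroup H] [InnerProductSpace ℂ H] [CompleteSpace H]
  {a b : ℕ → H →L[ℂ] H}

lemma rpow_sandwich_nonneg {A B : H →L[ℂ] H} (hB : 0 ≤ B) (x : ℝ) : 0 ≤ A ^ x * B * A ^ x :=
  (IsSelfAdjoint.of_nonneg (CFC.rpow_nonneg (a := A) (y := x))).conjugate_nonneg hB

lemma sandwich_eqInMeasure (ha : ∀ n, 0 ≤ a n) (hab : BoundedInMeasure a)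
    (hcomm : ∀ ε δ : ℝ, 0 < ε → 0 < δ →
      EqInMeasure (fun n => a n ^ ε * b n ^ δ) (fun n => b n ^ δ * a n ^ ε))
    {x : ℝ} (hx : 0 < x) :
    EqInMeasure (fun n => a n ^ (x / 2) * b n ^ x * a n ^ (x / 2))
      (fun n => b n ^ x * a n ^ x) := by
  have h := (hcomm (x / 2) x (by positivity) hx).mul_right (hab.rpow ha (half_pos hx))
  simpa only [mul_assoc, ← rpow_add_of_pos (ha _) (half_pos hx) (half_pos hx), add_halves] using h

/-- The induction runs over exponents `j + 1`, which keeps all real exponents positive: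
`a ^ x * a ^ y = a ^ (x + y)` and the commutation hypothesis are available for those only. -/
lemma sandwich_pow_eqInMeasure (ha : ∀ n, 0 ≤ a n) (hb : ∀ n, 0 ≤ b n) (hab : BoundedInMeasure a)
    (hbb : BoundedInMeasure b)
    (hcomm : ∀ ε δ : ℝ, 0 < ε → 0 < δ →
      EqInMeasure (fun n => a n ^ ε * b n ^ δ) (fun n => b n ^ δ * a n ^ ε))
    {x : ℝ} (hx : 0 < x) (j : ℕ) :
    EqInMeasure (fun n => (a n ^ (x / 2) * b n ^ x * a n ^ (x / 2)) ^ (j + 1))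
      (fun n => b n ^ ((j + 1) * x) * a n ^ ((j + 1) * x)) := by
  have hα := hab.rpow ha (half_pos hx)
  have hβ := hbb.rpow hb hx
  have hα' := hab.rpow ha hx
  induction j with
  | zero => simpa using sandwich_eqInMeasure ha hab hcomm hx
  | succ j ih =>
    have hj : 0 < (j + 1) * x := by positivity
    have h1 := ih.mul (sandwich_eqInMeasure ha hab hcomm hx) ((hα.mul hβ).mul hα)
      ((hbb.rpow hb hj).mul (hab.rpow ha hj))
    -- Move `b ^ x` to the left past `a ^ ((j + 1) * x)`.
    have h2 := EqInMeasure.mul_left (hbb.rpow hb hj) ((hcomm _ _ hj hx).mul_right hα')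
    simp only [← pow_succ] at h1
    have hsum : (((j + 1 : ℕ) : ℝ) + 1) * x = (j + 1) * x + x := by push_cast; ring
    simp only [mul_assoc] at h1 h2 ⊢
    simp only [hsum, rpow_add_of_pos (ha _) hj hx, rpow_add_of_pos (hb _) hj hx, mul_assoc]
    exact h1.trans h2

/-- For a rational exponent, up to null sequences, both sides are the power `k + 1` of
`Y = a ^ (x / 2) * b ^ x * a ^ (x / 2)` with `x = 1 / (m + 1)`, which is an `(m + 1)`-th root of the
sandwiched product. -/
lemma mul_rpow_eqInMeasure_of_rat (ha : ∀ n, 0 ≤ a n) (hb : ∀ n, 0 ≤ b n)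
    (hab : BoundedInMeasure a) (hbb : BoundedInMeasure b)
    (hcomm : ∀ ε δ : ℝ, 0 < ε → 0 < δ →
      EqInMeasure (fun n => a n ^ ε * b n ^ δ) (fun n => b n ^ δ * a n ^ ε)) (k m : ℕ) :
    EqInMeasure
      (fun n => b n ^ ((k + 1 : ℝ) / (m + 1)) * a n ^ ((k + 1 : ℝ) / (m + 1)))
      (fun n => (a n ^ (1 / 2 : ℝ) * b n * a n ^ (1 / 2 : ℝ)) ^ ((k + 1 : ℝ) / (m + 1))) := by
  have hx : 0 < 1 / ((m : ℝ) + 1) := by positivity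
  have hα := hab.rpow ha (half_pos hx)
  have hβ := hbb.rpow hb hx
  have hhalf := hab.rpow ha (one_half_pos (α := ℝ))
  set x := 1 / ((m : ℝ) + 1) with hxdef
  have hmx : ((m : ℝ) + 1) * x = 1 := by rw [hxdef]; field_simp
  have hkx : ((k : ℝ) + 1) / (m + 1) = (k + 1) * x := by rw [hxdef]; ring
  set Y : ℕ → H →L[ℂ] H := fun n => a n ^ (x / 2) * b n ^ x * a n ^ (x / 2) with hY
  have hY0 : ∀ n, 0 ≤ Y n := fun n => rpow_sandwich_nonneg CFC.rpow_nonneg _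
  have hYb : BoundedInMeasure Y := (hα.mul hβ).mul hα
  have h1 : EqInMeasure (fun n => Y n ^ (m + 1)) (fun n => b n * a n) := by
    simpa only [hmx, CFC.rpow_one (a _) (ha _), CFC.rpow_one (b _) (hb _)] using
      sandwich_pow_eqInMeasure ha hb hab hbb hcomm hx m
  have h2 : EqInMeasure (fun n => a n ^ (1 / 2 : ℝ) * b n * a n ^ (1 / 2 : ℝ))
      (fun n => b n * a n) := by
    simpa only [CFC.rpow_one (a _) (ha _), CFC.rpow_one (b _) (hb _)] using
      sandwich_eqInMeasure ha hab hcomm one_pos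
  have hYpow : ∀ n, 0 ≤ Y n ^ (m + 1) := fun n => by
    rw [← CFC.rpow_natCast (Y n) (m + 1) (hY0 n)]
    exact CFC.rpow_nonneg
  have hpow : ∀ n, (Y n ^ (m + 1)) ^ ((k + 1 : ℝ) / (m + 1)) = Y n ^ (k + 1) := by
    intro n
    rw [← CFC.rpow_natCast (Y n) (m + 1) (hY0 n), CFC.rpow_rpow_of_exponent_nonneg _ _ _
      (by positivity) (by positivity) (hY0 n), ← CFC.rpow_natCast (Y n) (k + 1) (hY0 n)]
    congr 1
    push_cast
    field_simp
  have h3 := EqInMeasure.rpow (s := (k + 1 : ℝ) / (m + 1)) hYpow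
    (fun n => rpow_sandwich_nonneg (hb n) _) (hYb.pow _) ((hhalf.mul hbb).mul hhalf)
    (h1.trans h2.symm) (by positivity)
  simp only [hpow] at h3
  have h4 := sandwich_pow_eqInMeasure ha hb hab hbb hcomm hx k
  rw [← hkx] at h4
  exact h4.symm.trans h3

/-- Positive sequences that are bounded in measure and all of whose powers commute in the limit
behave like commuting positive operators. -/
theorem mul_rpow_eqInMeasure (ha : ∀ n, 0 ≤ a n) (hb : ∀ n, 0 ≤ b n)
    (hab : BoundedInMeasure a) (hbb : BoundedInMeasure b)
    (hcomm : ∀ ε δ : ℝ, 0 < ε → 0 < δ →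
      EqInMeasure (fun n => a n ^ ε * b n ^ δ) (fun n => b n ^ δ * a n ^ ε))
    {s : ℝ} (hs : 0 < s) :
    EqInMeasure (fun n => b n ^ s * a n ^ s)
      (fun n => (a n ^ (1 / 2 : ℝ) * b n * a n ^ (1 / 2 : ℝ)) ^ s) := by
  intro ε hε
  have hhalf := hab.rpow ha (one_half_pos (α := ℝ))
  have hε8 : 0 < ε / 8 := by positivity
  obtain ⟨M, hM⟩ := hab.rpow ha hs (ε / 8) hε8
  obtain ⟨N, hN⟩ := hbb.rpow hb hs (ε / 8) hε8
  set K := max (max M N) 1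
  have hK : 1 ≤ K := le_max_right _ _
  -- `δ` absorbs the bounds `M` and `N` of the powers of `a` and `b`, and `δ * δ ≤ ε / 8`.
  set δ := min (ε / 8 / K) 1
  have hδ : 0 < δ := by positivity
  have hδK : δ * K ≤ ε / 8 := (le_div_iff₀ (by positivity)).1 (min_le_left _ _)
  have hδ1 : δ ≤ 1 := min_le_right _ _
  have hδε : δ ≤ ε / 8 := by nlinarith
  obtain ⟨t, ht⟩ := Rat.denseRange_cast.mem_nhds (inter_mem (inter_mem
    (hab.eventually_rpow_sub_rpow ha hs hδ) (hbb.eventually_rpow_sub_rpow hb hs hδ))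
    (inter_mem (((hhalf.mul hbb).mul hhalf).eventually_rpow_sub_rpow
      (fun n => rpow_sandwich_nonneg (hb n) _) hs hε8) (eventually_gt_nhds hs)))
  obtain ⟨⟨hta, htb⟩, htX, ht0⟩ := ht
  obtain ⟨k, m, hkm⟩ : ∃ k m : ℕ, (t : ℝ) = (k + 1 : ℝ) / (m + 1) := by
    have ht0' : 0 < t := by exact_mod_cast (show (0 : ℝ) < t from ht0)
    obtain ⟨k, hk⟩ := Int.eq_succ_of_zero_lt (Rat.num_pos.2 ht0')
    obtain ⟨m, hm⟩ := Nat.exists_eq_succ_of_ne_zero t.den_nz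
    refine ⟨k, m, ?_⟩
    rw [Rat.cast_def, hk, hm]
    push_cast
    rfl
  have hrat := mul_rpow_eqInMeasure_of_rat ha hb hab hbb hcomm k m (ε / 8) hε8
  rw [← hkm] at hrat
  filter_upwards [hM, hN, hta, htb, htX, hrat] with n h1 h2 h3 h4 h5 h6
  have hn : (0 : ℝ) ≤ n := n.cast_nonneg
  have hδn : δ * n ≤ ε / 8 * n := by gcongr
  -- `b ^ s a ^ s - b ^ t a ^ t` is the sum of `(b ^ s - b ^ t) a ^ s` and `b ^ s (a ^ s - a ^ t)`,
  -- minus `(b ^ s - b ^ t) (a ^ s - a ^ t)`. This form needs bounds at the exponent `s` only, which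
  -- can be fixed before `t` is chosen.
  have e1 := (h4.mul h1).mono (r' := ε / 4 * n) (c' := ε / 8) (by linarith)
    ((mul_le_mul_of_nonneg_left ((le_max_left M N).trans (le_max_left _ 1)) hδ.le).trans hδK)
  have e2 := (h2.mul h3).mono (r' := ε / 4 * n) (c' := ε / 8) (by linarith)
    ((mul_le_mul_of_nonneg_right ((le_max_right M N).trans (le_max_left _ 1)) hδ.le).trans
      (by linarith))
  have e3 := (h4.mul h3).mono (r' := ε / 4 * n) (c' := ε / 8) (by linarith) (by nlinarith)
  have := ((((e1.add e2).sub e3).sub h5).add h6).mono (r' := ε * n) (c' := ε) (by linarith)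
    (by linarith)
  convert this using 1
  noncomm_ring

end Commuting

theorem mainTheorem5 {H : Type*} [NormedAddCommGroup H] [InnerProductSpace ℂ H]
    [CompleteSpace H] [TopologicalSpace.SeparableSpace H]
    (q : ℝ) (hq : 0 < q) (A B : H →L[ℂ] H) (hA : 0 ≤ A) (hB : 0 ≤ B)
    (hBq : B ∈ weakSchatten H q)
    (hAB : ∀ ε δ : ℝ, 0 < ε → 0 < δ →
      A ^ ε * B ^ δ - B ^ δ * A ^ ε ∈ weakSchattenSeparablePart H (q / δ)) :
    ∀ s : ℝ, 0 < s →
      B ^ s * A ^ s - (A ^ (1 / 2 : ℝ) * B * A ^ (1 / 2 : ℝ)) ^ s ∈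
        weakSchattenSeparablePart H (q / s) := by
  intro s hs
  have hscale : ∀ C : H →L[ℂ] H, 0 ≤ C → ∀ δ : ℝ, 0 < δ → ∀ n : ℕ,
      ((n : ℝ) ^ (1 / q) • C) ^ δ = (n : ℝ) ^ (1 / (q / δ)) • C ^ δ := by
    intro C hC δ hδ n
    rw [real_smul_rpow hC (by positivity) hδ, ← Real.rpow_mul n.cast_nonneg]
    congr 2
    field_simp
  refine mem_separablePart_of_nullInMeasure (by positivity) ?_
  have h := mul_rpow_eqInMeasure (a := fun _ => A) (b := fun n : ℕ => (n : ℝ) ^ (1 / q) • B)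
    (fun _ => hA) (fun n => smul_nonneg (by positivity) hB) (.const A)
    (boundedInMeasure_of_mem_weakSchatten hq hBq) ?_ hs
  · unfold EqInMeasure at h
    convert h using 2 with n
    beta_reduce
    rw [hscale B hB s hs, mul_smul_comm, smul_mul_assoc, smul_mul_assoc,
      hscale _ (rpow_sandwich_nonneg hB _) s hs, ← smul_sub]
  · intro ε δ hε hδ
    unfold EqInMeasure
    convert nullInMeasure_of_mem_separablePart (by positivity) (hAB ε δ hε hδ) using 2 with n
    beta_reduce
    rw [hscale B hB δ hδ, mul_smul_comm, smul_mul_assoc, smul_sub]
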